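/- Let $n\ge 2$, $k>s\ge 0$, $\lambda\ge 1$ and $1\le p_{\max}\le\lambda$ be integers. For $x=(x(i_1,\dots,i_k))\in\mathbb{R}^{n^k}$, indexed by $(i_1,\dots,i_k)\in\{1,\dots,n\}^k$, consider the equality constraints $$\sum_{(i_1,\dots,i_k)\,:\; i_j=a_j\ \forall j\in J} x(i_1,\dots,i_k)=\lambda\qquad\text{for all } J\subseteq\{1,\dots,k\},\ |J|=s,\ \text{and all } (a_j)_{j\in J}\in\{1,\dots,n\}^J. \qquad (*)$$ Let $P^{(k,s,\lambda)}_{n}$ be the set of all $x\in\mathbb{R}^{n^k}$ that satisfy $(*)$ and $0\le x(i_1,\dots,i_k)\le p_{\max}$ for all $(i_1,\dots,i_k)$, and let $P^{(k,s,\lambda)}_{n;I}$ be the convex hull of the integer points of $P^{(k,s,\lambda)}_{n}$. The dimension of a nonempty set is the dimension of its affine hull. Suppose that $n\nmid\lambda\binom{s+\ell-1}{\ell-1}$ for every $\ell=1,\dots,k-s$, and that $P^{(k,s,\lambda)}_{n;I}\neq\emptyset$. Then $P^{(k,s,\lambda)}_{n;I}$ is full-dimensional in the affine space of the linear relaxation,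 i.e. its affine hull is the set of all $x\in\mathbb{R}^{n^k}$ satisfying $(*)$, and $$\dim P^{(k,s,\lambda)}_{n;I}=\dim P^{(k,s,\lambda)}_{n}=n^k-\sum_{j=0}^{s}\binom{k}{j}(n-1)^j .$$ In particular, for the assignment polytopes $P^{(k,s)}_{n;I}:=P^{(k,s,1)}_{n;I}$ (so $\lambda=p_{\max}=1$): $\dim P^{(k,0)}_{n;I}=n^k-1$ for $n\ge 2$, $k\ge 1$; $\dim P^{(2,1)}_{n;I}=(n-1)^2$ for $n\ge 2$; $\dim P^{(3,1)}_{n;I}=n^3-3n+2$ for $n\ge 3$; $\dim P^{(3,2)}_{n;I}=(n-1)^3$ for $n\ge 4$; and $\dim P^{(4,2)}_{n;I}=n^4-6n^2+8n-3$ for every $n\ge 4$ with $P^{(4,2)}_{n;I}\ne\emptyset$. -/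

import Mathlib

namespace OrthogonalArray

/-- The equality constraints of the orthogonal array problem: for every set `J` of `s` columns and
every choice `a` of symbols in these columns, the entries `x i` over all symbol combinations `i`
that agree with `a` on `J` sum to `lam`. The `n` symbols are the elements of `Fin n`. -/
def EqualityConstraints (n k s lam : ℕ) (x : (Fin k → Fin n) → ℝ) : Prop :=
  ∀ J : Finset (Fin k), J.card = s → ∀ a : J → Fin n,
    ∑ i : Fin k → Fin n with (∀ j : J, i j = a j), x i = (lam : ℝ)

/-- The affine space cut out by the equality constraints (as a set). -/
def affineSolutionSet (n k s lam : ℕ) : Set ((Fin k → Fin n) → ℝ) :=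
  {x | EqualityConstraints n k s lam x}

/-- The linear orthogonal array polytope: all real feasible points of the linear relaxation,
where every variable lies between `0` and `pmax`. -/
def linearPolytope (n k s lam pmax : ℕ) : Set ((Fin k → Fin n) → ℝ) :=
  {x | EqualityConstraints n k s lam x ∧ ∀ i, 0 ≤ x i ∧ x i ≤ (pmax : ℝ)}

/-- The orthogonal array polytope: the convex hull of the integer feasible points. -/
def integerPolytope (n k s lam pmax : ℕ) : Set ((Fin k → Fin n) → ℝ) :=
  convexHull ℝ {x | x ∈ linearPolytope n k s lam pmax ∧ ∀ i, ∃ z : ℤ, x i = (z : ℝ)}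

/-- The dimension of a (nonempty) set of points: the dimension of its affine hull. -/
noncomputable def affineDim {V : Type*} [AddCommGroup V] [Module ℝ V] (S : Set V) : ℕ :=
  Module.finrank ℝ (affineSpan ℝ S).direction

end OrthogonalArray

/-!
The space of functions on `k`-tuples of symbols splits, under the permutations of the symbols in
each column, into one component for every set `J` of columns: the tensors that have sum zero in each
column of `J` and are constant in the others. The homogeneous solutions of the equality constraints
are the sum of the components with `#J > s`, and the direction space of the integer polytope is
contained in it. It remains to see that each component with `#J > s` occurs in this direction space.

Invariance under symbol permutations reduces this to exhibiting one nonzero coordinate. Concretely,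
a product of suitable weights on permutations maps an integer point `x` to its contrast on `J` times
a contrast vector, and since the weights have sum zero the image lies in the direction space
(`contrastVector_mem`). The contrast is an alternating sum over `K ⊆ J` of `n ^ #K` times a marginal
of `x`. The terms with `#K ≤ s` are determined by the constraints and add up to
`± n ^ s * lam * (#J - 1).choose s`, and the other terms are divisible by `n ^ (s + 1)` because `x`
is integral. A vanishing contrast would therefore make `n` divide `lam * (#J - 1).choose s`, which
the hypothesis excludes (`contrast_ne_zero`).

The contrast vectors are a basis, with the contrasts as dual basis up to scale
(`contrast_contrastVector`). Hence every homogeneous solution is a combination of the contrast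
vectors with support larger than `s` (`homogeneousSolutions_le_span`), all direction spaces involved
coincide, and the dimension is the number of tuples with more than `s` entries different from a base
symbol (`card_lt_card_supp`).
-/

namespace OrthogonalArray

open Finset

variable {n k : ℕ}

/-! ### Marginals -/

/-- The marginal of `x` on the columns `K` at the symbols `a`: the sum of `x m` over all `m` that
agree with `a` on `K`. The values of `a` off `K` play no role; taking a total function `a` avoids
the subtype of `K`. -/
def marginal (x : (Fin k → Fin n) → ℝ) (K : Finset (Fin k)) (a : Fin k → Fin n) : ℝ :=
  ∑ m : Fin k → Fin n with (∀ j ∈ K, m j = a j), x m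

theorem equalityConstraints_iff (z : Fin n) {s lam : ℕ} {x : (Fin k → Fin n) → ℝ} :
    EqualityConstraints n k s lam x ↔
      ∀ J : Finset (Fin k), #J = s → ∀ a : Fin k → Fin n, marginal x J a = lam := by
  constructor
  · intro h J hJ a
    rw [← h J hJ fun j => a j, marginal]
    congr 1
    ext m
    simp
  · intro h J hJ a
    rw [← h J hJ fun j => if hj : j ∈ J then a ⟨j, hj⟩ else z, marginal]
    congr 1
    ext m
    simp +contextual

theorem marginal_eq_sum_update (x : (Fin k → Fin n) → ℝ) {K : Finset (Fin k)} {j : Fin k}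
    (hj : j ∉ K) (a : Fin k → Fin n) :
    marginal x K a = ∑ b : Fin n, marginal x (insert j K) (Function.update a j b) := by
  simp only [marginal]
  rw [← Finset.sum_fiberwise _ (fun m => m j)]
  refine Finset.sum_congr rfl fun b _ => ?_
  rw [Finset.filter_filter]
  congr 1
  ext m
  simp only [mem_filter, mem_univ, true_and, Finset.forall_mem_insert, Function.update_self]
  rw [and_comm]
  refine and_congr_right fun _ => forall₂_congr fun i hi => ?_
  rw [Function.update_of_ne (ne_of_mem_of_not_mem hi hj)]

/-- Constant marginals on `s` columns determine all marginals on fewer columns. -/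
theorem marginal_eq_of_card_le {s : ℕ} (hs : s ≤ k) {x : (Fin k → Fin n) → ℝ} {c : ℝ}
    (h : ∀ J : Finset (Fin k), #J = s → ∀ a : Fin k → Fin n, marginal x J a = c)
    {K : Finset (Fin k)} (hK : #K ≤ s) (a : Fin k → Fin n) :
    marginal x K a = n ^ (s - #K) * c := by
  obtain ⟨r, hr⟩ := Nat.exists_eq_add_of_le hK
  induction r generalizing K a with
  | zero => simp [h K hr.symm a, hr]
  | succ r ih =>
    obtain ⟨j, hj⟩ : ∃ j, j ∉ K := by
      by_contra! hall
      have : #K = k := by rw [Finset.eq_univ_iff_forall.2 hall, Finset.card_univ, Fintype.card_fin]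
      omega
    have hcard : #(insert j K) = #K + 1 := Finset.card_insert_of_notMem hj
    rw [marginal_eq_sum_update x hj,
      Finset.sum_congr rfl fun b _ => ih (by omega) (Function.update a j b) (by omega),
      Finset.sum_const, Finset.card_univ, Fintype.card_fin, nsmul_eq_mul, hcard, ← mul_assoc,
      ← pow_succ', show s - (#K + 1) + 1 = s - #K by omega]

/-! ### Contrasts and their arithmetic -/

/-- The pairing of `x` with the tensor product over `j ∈ J` of the functions `n • e_{a j} - 1` of
the symbol in column `j`, constant in the other columns. Each factor has sum zero, so up to scale
this is the value at `a` of the component of `x` of pure interaction type `J`. -/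
def contrast (x : (Fin k → Fin n) → ℝ) (J : Finset (Fin k)) (a : Fin k → Fin n) : ℝ :=
  ∑ p : Fin k → Fin n, x p * ∏ j ∈ J, ((n : ℝ) * (if p j = a j then 1 else 0) - 1)

theorem contrast_eq_sum_marginal (x : (Fin k → Fin n) → ℝ) (J : Finset (Fin k))
    (a : Fin k → Fin n) :
    contrast x J a =
      ∑ K ∈ J.powerset, (-1) ^ (#J - #K) * (n : ℝ) ^ #K * marginal x K a := by
  simp only [contrast, sub_eq_add_neg, Finset.prod_add, Finset.mul_sum]
  rw [Finset.sum_comm]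
  refine Finset.sum_congr rfl fun K hK => ?_
  rw [marginal, Finset.sum_filter, Finset.mul_sum]
  refine Finset.sum_congr rfl fun p _ => ?_
  rw [Finset.prod_const, Finset.card_sdiff_of_subset (Finset.mem_powerset.1 hK),
    Finset.prod_mul_distrib, Finset.prod_const, Finset.prod_boole]
  split_ifs <;> ring

/-- The arithmetic core. In the expansion of the contrast of an integer point over `K ⊆ J`, the sets
with `#K ≤ s` have prescribed marginals and contribute `± n ^ s * lam * (#J - 1).choose s`, while
the remaining terms are divisible by `n ^ (s + 1)`. -/
theorem contrast_ne_zero {s lam : ℕ} (hn : n ≠ 0) (hs : s ≤ k) {x : (Fin k → Fin n) → ℝ}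
    (h : ∀ J : Finset (Fin k), #J = s → ∀ a : Fin k → Fin n, marginal x J a = lam)
    (hx : ∀ i, ∃ z : ℤ, x i = z) {J : Finset (Fin k)} (hJ : s < #J)
    (hdvd : ¬ n ∣ lam * (#J - 1).choose s) (a : Fin k → Fin n) : contrast x J a ≠ 0 := by
  choose y hy using hx
  intro h0
  apply hdvd
  set M : Finset (Fin k) → ℤ := fun K => ∑ m : Fin k → Fin n with (∀ j ∈ K, m j = a j), y m
  have hM (K) : marginal x K a = M K := by simp [marginal, M, hy]
  have hMs (K) (hK : #K ≤ s) : M K = n ^ (s - #K) * lam := by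
    have := marginal_eq_of_card_le hs h hK a
    rw [hM] at this
    exact_mod_cast this
  have h1 : ∑ K ∈ J.powerset, (-1) ^ (#J - #K) * (n : ℤ) ^ #K * M K = 0 := by
    rw [contrast_eq_sum_marginal] at h0
    simp only [hM] at h0
    exact_mod_cast h0
  rw [← Finset.sum_filter_add_sum_filter_not _ (fun K => #K ≤ s)] at h1
  have hlow : ∑ K ∈ J.powerset with #K ≤ s, (-1) ^ (#J - #K) * (n : ℤ) ^ #K * M K =
      (-1) ^ #J * (n ^ s * (lam * ((-1) ^ s * ((#J - 1).choose s : ℤ)))) := by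
    have hterm : ∀ K ∈ J.powerset.filter (fun K => #K ≤ s),
        (-1) ^ (#J - #K) * (n : ℤ) ^ #K * M K =
          (-1) ^ #J * (n ^ s * (lam * (-1) ^ #K)) := by
      intro K hK
      rw [mem_filter, mem_powerset] at hK
      have hle := Finset.card_le_card hK.1
      rw [hMs K hK.2]
      have e1 : (-1 : ℤ) ^ (#J - #K) = (-1) ^ #J * (-1) ^ #K := by
        rw [← pow_add, show #J + #K = (#J - #K) + 2 * #K by omega, pow_add, pow_mul]
        simp
      have e2 : (n : ℤ) ^ s = n ^ #K * n ^ (s - #K) := by rw [← pow_add]; congr 1; omega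
      rw [e1, e2]
      ring
    rw [Finset.sum_congr rfl hterm, ← Finset.mul_sum, ← Finset.mul_sum, ← Finset.mul_sum]
    congr 3
    have : ∑ K ∈ J.powerset with #K ≤ s, (-1 : ℤ) ^ #K =
        ∑ t ∈ range (s + 1), (-1 : ℤ) ^ t * ((#J).choose t : ℤ) := by
      rw [← Finset.sum_fiberwise_of_maps_to (t := range (s + 1)) (g := fun K => #K)
        (by intro K hK; rw [mem_filter] at hK; simpa [Nat.lt_succ_iff] using hK.2)]
      refine Finset.sum_congr rfl fun t ht => ?_
      rw [Finset.mem_range] at ht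
      have : (J.powerset.filter (fun K => #K ≤ s)).filter (fun K => #K = t)
          = J.powersetCard t := by
        ext K
        simp only [mem_filter, mem_powerset, mem_powersetCard]
        constructor
        · rintro ⟨⟨h1, -⟩, h2⟩; exact ⟨h1, h2⟩
        · rintro ⟨h1, h2⟩; exact ⟨⟨h1, by omega⟩, h2⟩
      rw [this, Finset.sum_congr rfl fun K hK => by rw [(mem_powersetCard.1 hK).2],
        Finset.sum_const, card_powersetCard, nsmul_eq_mul, mul_comm]
    rw [this]
    obtain ⟨N, hN⟩ : ∃ N, #J = N + 1 := ⟨#J - 1, by omega⟩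
    rw [hN]
    exact Int.alternating_sum_range_choose_eq_choose
  have hhigh : (n : ℤ) ^ (s + 1) ∣
      ∑ K ∈ J.powerset with ¬ #K ≤ s, (-1) ^ (#J - #K) * (n : ℤ) ^ #K * M K := by
    refine Finset.dvd_sum fun K hK => ?_
    rw [mem_filter] at hK
    exact ((pow_dvd_pow _ (by omega)).mul_left _).mul_right _
  rw [hlow] at h1
  rw [add_eq_zero_iff_eq_neg] at h1
  have h2 : (n : ℤ) ^ s * n ∣
      n ^ s * ((-1) ^ #J * ((-1) ^ s * ((lam : ℤ) * (#J - 1).choose s))) := by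
    rw [← pow_succ]
    refine (dvd_neg.2 hhigh).trans (dvd_of_eq ?_)
    rw [← h1]
    ring
  have h3 := Int.dvd_of_mul_dvd_mul_left (by positivity) h2
  rw [IsUnit.dvd_mul_left ((isUnit_neg_one).pow _), IsUnit.dvd_mul_left ((isUnit_neg_one).pow _)]
    at h3
  exact_mod_cast h3

/-! ### A basis adapted to the contrasts -/

/-- The set of columns in which `i` differs from the base symbol `z`. -/
def supp (z : Fin n) (i : Fin k → Fin n) : Finset (Fin k) := {j | i j ≠ z}

/-- The tensor product over the columns `j` of `e_{i j} - e_z` if `i j ≠ z` and of the constant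
function `1` if `i j = z`. -/
def contrastVector (z : Fin n) (i : Fin k → Fin n) (m : Fin k → Fin n) : ℝ :=
  ∏ j, if i j = z then 1 else (if m j = i j then 1 else 0) - (if m j = z then 1 else 0)

/-- The solutions of the homogeneous equality constraints: all marginals on `s` columns vanish. -/
def homogeneousSolutions (n k s : ℕ) : Submodule ℝ ((Fin k → Fin n) → ℝ) where
  carrier := {x | ∀ J : Finset (Fin k), #J = s → ∀ a : Fin k → Fin n, marginal x J a = 0}
  add_mem' hx hy J hJ a := by
    have := congrArg₂ (· + ·) (hx J hJ a) (hy J hJ a)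
    simpa [marginal, Finset.sum_add_distrib] using this
  zero_mem' J hJ a := by simp [marginal]
  smul_mem' c x hx J hJ a := by
    have := congrArg (c * ·) (hx J hJ a)
    simpa [marginal, Finset.mul_sum] using this

theorem contrast_eq_zero {s : ℕ} (hs : s ≤ k) {x : (Fin k → Fin n) → ℝ}
    (hx : x ∈ homogeneousSolutions n k s) {J : Finset (Fin k)} (hJ : #J ≤ s)
    (a : Fin k → Fin n) : contrast x J a = 0 := by
  rw [contrast_eq_sum_marginal]
  refine Finset.sum_eq_zero fun K hK => ?_
  have := (Finset.card_le_card (Finset.mem_powerset.1 hK)).trans hJ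
  rw [marginal_eq_of_card_le hs hx this, mul_zero, mul_zero]

/-- Up to the factor `n ^ k`, the contrasts are the coordinate functionals dual to the contrast
vectors. -/
theorem contrast_contrastVector (z : Fin n) (i i' : Fin k → Fin n) :
    contrast (contrastVector z i) (supp z i') i' = if i = i' then (n : ℝ) ^ k else 0 := by
  -- Both sides are products over the columns; this is the sum over the symbols in one column.
  have key : ∀ b b' : Fin n, ∑ m : Fin n,
      (if b = z then 1 else (if m = b then (1 : ℝ) else 0) - (if m = z then 1 else 0)) *
        (if b' = z then 1 else (n : ℝ) * (if m = b' then 1 else 0) - 1) =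
      if b = b' then (n : ℝ) else 0 := by
    intro b b'
    by_cases hb : b = z <;> by_cases hb' : b' = z <;>
      simp [hb, hb', sub_mul, mul_sub, Finset.sum_sub_distrib, ite_mul, mul_ite]
    · simp [Ne.symm hb']
    · simp [eq_comm]
  have hprod : ∀ p : Fin k → Fin n,
      contrastVector z i p * ∏ j ∈ supp z i', ((n : ℝ) * (if p j = i' j then 1 else 0) - 1) =
      ∏ j, ((if i j = z then 1 else
          (if p j = i j then (1 : ℝ) else 0) - (if p j = z then 1 else 0)) *
        (if i' j = z then 1 else (n : ℝ) * (if p j = i' j then 1 else 0) - 1)) := by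
    intro p
    rw [Finset.prod_mul_distrib, contrastVector, supp, Finset.prod_filter]
    simp only [ne_eq, ite_not]
  rw [contrast, Finset.sum_congr rfl fun p _ => hprod p]
  have := (Finset.prod_univ_sum (fun _ : Fin k => (univ : Finset (Fin n))) fun j m =>
    (if i j = z then 1 else (if m = i j then (1 : ℝ) else 0) - (if m = z then 1 else 0)) *
        (if i' j = z then 1 else (n : ℝ) * (if m = i' j then 1 else 0) - 1)).symm
  rw [Fintype.piFinset_univ] at this
  rw [this, Finset.prod_congr rfl fun j _ => key (i j) (i' j)]
  split_ifs with h
  · simp [h]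
  · obtain ⟨j, hj⟩ := Function.ne_iff.1 h
    exact Finset.prod_eq_zero (mem_univ j) (if_neg hj)

/-- The coordinates with respect to the contrast vectors, as contrasts scaled by `n ^ (-k)`. -/
noncomputable def contrastMap (z : Fin n) :
    ((Fin k → Fin n) → ℝ) →ₗ[ℝ] ((Fin k → Fin n) → ℝ) where
  toFun x i := (n : ℝ)⁻¹ ^ k * contrast x (supp z i) i
  map_add' x y := by
    ext i
    simp [contrast, add_mul, Finset.sum_add_distrib, mul_add]
  map_smul' c x := by
    ext i
    simp only [contrast, Finset.mul_sum, Pi.smul_apply, smul_eq_mul, RingHom.id_apply]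
    exact Finset.sum_congr rfl fun p _ => by ring

theorem contrastMap_contrastVector (z : Fin n) (i : Fin k → Fin n) :
    contrastMap z (contrastVector z i) = Pi.single i 1 := by
  have : (n : ℝ) ≠ 0 := by have := z.pos; positivity
  ext i'
  change (n : ℝ)⁻¹ ^ k * contrast (contrastVector z i) (supp z i') i' = _
  rw [contrast_contrastVector, Pi.single_apply]
  by_cases h : i = i'
  · simp [h, this]
  · simp [h, Ne.symm h]

theorem linearIndependent_contrastVector (z : Fin n) :
    LinearIndependent ℝ (contrastVector z : (Fin k → Fin n) → _) := by
  refine LinearIndependent.of_comp (contrastMap z) ?_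
  have : contrastMap z ∘ contrastVector z = fun i : Fin k → Fin n => Pi.single i (1 : ℝ) :=
    funext fun i => contrastMap_contrastVector z i
  rw [this]
  exact Pi.linearIndependent_single_one _ _

theorem sum_contrastMap_smul_contrastVector (z : Fin n) (x : (Fin k → Fin n) → ℝ) :
    ∑ i, contrastMap z x i • contrastVector z i = x := by
  have h := (mul_eq_one_comm (a := contrastMap (k := k) z)
    (b := Fintype.linearCombination ℝ (contrastVector z))).1 (by
      refine LinearMap.pi_ext' fun i => LinearMap.ext_ring ?_
      simp [Fintype.linearCombination_apply_single, contrastMap_contrastVector])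
  simpa [Fintype.linearCombination_apply] using LinearMap.congr_fun h x

/-- A homogeneous solution has vanishing contrasts on at most `s` columns, so only the contrast
vectors with larger support occur in its expansion. -/
theorem homogeneousSolutions_le_span (z : Fin n) {s : ℕ} (hs : s ≤ k) :
    homogeneousSolutions n k s ≤
      Submodule.span ℝ (contrastVector z '' {i | s < #(supp z i)}) := by
  intro x hx
  rw [← sum_contrastMap_smul_contrastVector z x]
  refine Submodule.sum_mem _ fun i _ => ?_
  by_cases hi : s < #(supp z i)
  · exact Submodule.smul_mem _ _ (Submodule.subset_span ⟨i, hi, rfl⟩)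
  · have : contrastMap z x i = 0 := by
      change (n : ℝ)⁻¹ ^ k * contrast x (supp z i) i = 0
      rw [contrast_eq_zero hs hx (not_lt.1 hi), mul_zero]
    rw [this, zero_smul]
    exact Submodule.zero_mem _

/-! ### The number of contrast vectors of large support -/

theorem card_supp_eq (z : Fin n) (J : Finset (Fin k)) :
    #{i : Fin k → Fin n | supp z i = J} = (n - 1) ^ #J := by
  have : ({i : Fin k → Fin n | supp z i = J} : Finset _) =
      Fintype.piFinset fun j => if j ∈ J then univ.erase z else {z} := by
    ext i
    simp only [mem_filter, mem_univ, true_and, Fintype.mem_piFinset, Finset.ext_iff, supp]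
    refine forall_congr' fun j => ?_
    split_ifs with h <;> simp [h]
  rw [this, Fintype.card_piFinset]
  simp [apply_ite Finset.card]

theorem card_lt_card_supp (z : Fin n) (s : ℕ) :
    (#{i : Fin k → Fin n | s < #(supp z i)} : ℤ) =
      (n : ℤ) ^ k - ∑ j ∈ range (s + 1), (k.choose j : ℤ) * ((n : ℤ) - 1) ^ j := by
  have h1 : (#{i : Fin k → Fin n | ¬ s < #(supp z i)} : ℤ) =
      ∑ j ∈ range (s + 1), (k.choose j : ℤ) * ((n : ℤ) - 1) ^ j := by
    rw [Finset.card_eq_sum_card_fiberwise (f := fun i => #(supp z i)) (t := range (s + 1))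
      (by intro i hi; simpa [Nat.lt_succ_iff] using hi)]
    push_cast
    refine Finset.sum_congr rfl fun t ht => ?_
    rw [Finset.mem_range] at ht
    rw [Finset.card_eq_sum_card_fiberwise (f := supp z) (t := powersetCard t univ)
      (by intro i hi; rw [mem_coe, mem_filter] at hi; simpa using hi.2)]
    have : ∀ J ∈ powersetCard t (univ : Finset (Fin k)),
        #{a ∈ {a ∈ {i : Fin k → Fin n | ¬ s < #(supp z i)} | #(supp z a) = t} | supp z a = J} =
          (n - 1) ^ t := by
      intro J hJ
      have hJ := (mem_powersetCard.1 hJ).2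
      rw [← hJ, ← card_supp_eq z J]
      congr 1
      ext i
      simp only [mem_filter, mem_univ, true_and]
      constructor
      · exact fun h => h.2
      · rintro rfl
        exact ⟨⟨by omega, rfl⟩, rfl⟩
    rw [Finset.sum_congr rfl this, Finset.sum_const, card_powersetCard, Finset.card_univ,
      Fintype.card_fin, smul_eq_mul]
    push_cast [Nat.cast_sub (Nat.succ_le_of_lt z.pos)]
    simp
  have h2 := Finset.card_filter_add_card_filter_not (s := (univ : Finset (Fin k → Fin n)))
    (fun i => s < #(supp z i))
  rw [Finset.card_univ, Fintype.card_fun, Fintype.card_fin, Fintype.card_fin] at h2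
  rw [← h1]
  have : ((_ : ℕ) : ℤ) = ((_ : ℕ) : ℤ) := congrArg Nat.cast h2
  push_cast at this ⊢
  linarith

theorem finrank_span_contrastVector (z : Fin n) (s : ℕ) :
    Module.finrank ℝ
        (Submodule.span ℝ (contrastVector z '' {i : Fin k → Fin n | s < #(supp z i)})) =
      #{i : Fin k → Fin n | s < #(supp z i)} := by
  have := finrank_span_eq_card ((linearIndependent_contrastVector (k := k) z).comp
    ((↑) : {i : Fin k → Fin n | s < #(supp z i)} → _) Subtype.val_injective)
  rw [Set.range_comp, Subtype.range_coe] at this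
  rw [this, Fintype.card_subtype]
  rfl

/-! ### Symbol permutations generate contrast vectors -/

/-- In the group algebra of the symmetric group there is an element of augmentation zero that acts
on functions of one symbol as the rank-one operator `f ↦ ⟨n • e_a - 1, f⟩ • (e_i - e_z)`. -/
theorem exists_weight_eq_contrast {i z : Fin n} (hi : i ≠ z) (a : Fin n) :
    ∃ χ : Equiv.Perm (Fin n) → ℝ, ∑ σ, χ σ = 0 ∧ ∀ m p,
      ∑ σ, χ σ * (if σ m = p then 1 else 0) =
        ((if m = i then 1 else 0) - (if m = z then 1 else 0)) *
          ((n : ℝ) * (if p = a then 1 else 0) - 1) := by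
  -- As `n • e_a - 1 = ∑ b, (e_a - e_b)`, it suffices to treat `e_a - e_b` for every `b`.
  have hb : ∀ b : Fin n, ∃ χ : Equiv.Perm (Fin n) → ℝ, ∑ σ, χ σ = 0 ∧ ∀ m p,
      ∑ σ, χ σ * (if σ m = p then 1 else 0) =
        ((if m = i then 1 else 0) - (if m = z then 1 else 0)) *
          ((if p = a then 1 else 0) - (if p = b then 1 else 0)) := by
    intro b
    obtain rfl | hab := eq_or_ne a b
    · exact ⟨0, by simp, by simp⟩
    -- The weight is `σ - σ * swap i z` for a permutation `σ` taking `i` to `a` and `z` to `b`.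
    set τ := Equiv.swap i a with hτ
    have hτz : τ z ≠ a := by
      rw [← Equiv.swap_apply_left i a]
      exact fun h => hi (τ.injective h).symm
    set σ : Equiv.Perm (Fin n) := Equiv.swap (τ z) b * τ with hσ
    have hσi : σ i = a := by
      rw [hσ, Equiv.Perm.mul_apply, hτ, Equiv.swap_apply_left,
        Equiv.swap_apply_of_ne_of_ne hτz.symm hab]
    have hσz : σ z = b := by rw [hσ, Equiv.Perm.mul_apply, Equiv.swap_apply_left]
    refine ⟨Pi.single σ 1 - Pi.single (σ * Equiv.swap i z) 1, ?_, fun m p => ?_⟩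
    · simp [Finset.sum_sub_distrib]
    · simp only [Pi.sub_apply, sub_mul, Finset.sum_sub_distrib, Pi.single_apply, ite_mul, zero_mul,
        one_mul, Finset.sum_ite_eq', mem_univ, if_true, Equiv.Perm.mul_apply]
      obtain rfl | hm := eq_or_ne m i
      · simp [hi, hσi, hσz, eq_comm]
      obtain rfl | hm' := eq_or_ne m z
      · simp [hm, hσi, hσz, eq_comm]
      · simp [hm, hm', Equiv.swap_apply_of_ne_of_ne]
  choose χ h0 h1 using hb
  refine ⟨∑ b, χ b, ?_, fun m p => ?_⟩
  · simp only [Finset.sum_apply]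
    rw [Finset.sum_comm]
    simp [h0]
  · simp only [Finset.sum_apply, Finset.sum_mul]
    rw [Finset.sum_comm]
    simp only [h1]
    rw [← Finset.mul_sum, Finset.sum_sub_distrib]
    simp

/-- The sum of all permutations acts on functions of one symbol as a nonzero multiple of
summation. -/
theorem exists_weight_eq_const (z : Fin n) :
    ∃ χ : Equiv.Perm (Fin n) → ℝ, ∃ c : ℝ, c ≠ 0 ∧ ∀ m p,
      ∑ σ, χ σ * (if σ m = p then 1 else 0) = c := by
  refine ⟨1, ∑ σ : Equiv.Perm (Fin n), if σ z = z then 1 else 0, ?_, fun m p => ?_⟩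
  · refine (Finset.sum_pos' (fun σ _ => by split_ifs <;> simp) ⟨1, mem_univ _, ?_⟩).ne'
    simp
  · simp only [Pi.one_apply, one_mul]
    -- Composing with swaps on both sides turns the condition `σ m = p` into `σ z = z`.
    refine Fintype.sum_equiv
      ((Equiv.mulRight (Equiv.swap m z)).trans (Equiv.mulLeft (Equiv.swap p z))) _ _ fun σ => ?_
    congr 1
    simp [Equiv.swap_apply_eq_iff]

/-- A product weight on tuples of permutations acts on tensors factor by factor. -/
theorem sum_weight_mul_comp (χ : Fin k → Equiv.Perm (Fin n) → ℝ) (x : (Fin k → Fin n) → ℝ)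
    (m : Fin k → Fin n) :
    ∑ g : Fin k → Equiv.Perm (Fin n), (∏ j, χ j (g j)) * x (fun j => g j (m j)) =
      ∑ p, x p * ∏ j, ∑ σ, χ j σ * (if σ (m j) = p j then 1 else 0) := by
  have h : ∀ p : Fin k → Fin n, ∏ j, ∑ σ, χ j σ * (if σ (m j) = p j then (1 : ℝ) else 0) =
      ∑ g : Fin k → Equiv.Perm (Fin n),
        (∏ j, χ j (g j)) * if (fun j => g j (m j)) = p then 1 else 0 := by
    intro p
    rw [Finset.prod_univ_sum, Fintype.piFinset_univ]
    refine Finset.sum_congr rfl fun g _ => ?_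
    rw [Finset.prod_mul_distrib, Finset.prod_boole]
    simp [funext_iff]
  simp only [h, Finset.mul_sum]
  rw [Finset.sum_comm]
  refine Finset.sum_congr rfl fun g _ => ?_
  rw [Finset.sum_eq_single (fun j => g j (m j))]
  · simp [mul_comm]
  · intro p _ hp
    simp [hp.symm]
  · simp

/-- If `L` contains the differences between `x` and its images under permuting symbols in each
column, then it contains every contrast vector on whose support `x` has a nonzero contrast. -/
theorem contrastVector_mem {L : Submodule ℝ ((Fin k → Fin n) → ℝ)} {x : (Fin k → Fin n) → ℝ}
    (hL : ∀ g : Fin k → Equiv.Perm (Fin n), (fun m => x fun j => g j (m j)) - x ∈ L)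
    {z : Fin n} {i : Fin k → Fin n} (hi : (supp z i).Nonempty) {a : Fin k → Fin n}
    (hc : contrast x (supp z i) a ≠ 0) : contrastVector z i ∈ L := by
  obtain ⟨χ₀, c, hc0, hχ₀⟩ := exists_weight_eq_const z
  have : ∀ j, ∃ χ : Equiv.Perm (Fin n) → ℝ, (i j ≠ z → ∑ σ, χ σ = 0) ∧ ∀ m p,
      ∑ σ, χ σ * (if σ m = p then 1 else 0) =
        (if i j = z then 1 else (if m = i j then 1 else 0) - (if m = z then 1 else 0)) *
          (if i j = z then c else ((n : ℝ) * (if p = a j then 1 else 0) - 1)) := by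
    intro j
    by_cases hj : i j = z
    · exact ⟨χ₀, by simp [hj], by simpa [hj] using hχ₀⟩
    · obtain ⟨χ, h0, h1⟩ := exists_weight_eq_contrast hj (a j)
      exact ⟨χ, fun _ => h0, by simpa [hj] using h1⟩
  choose χ h0 h1 using this
  -- The weights on the support have sum zero, so subtracting `x` does not change the weighted sum.
  have hsum : ∑ g : Fin k → Equiv.Perm (Fin n), ∏ j, χ j (g j) = 0 := by
    obtain ⟨j, hj⟩ := hi
    have := (Finset.prod_univ_sum
      (fun _ : Fin k => (univ : Finset (Equiv.Perm (Fin n)))) χ).symm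
    rw [Fintype.piFinset_univ] at this
    rw [this]
    exact Finset.prod_eq_zero (mem_univ j) (h0 j (by simpa [supp] using hj))
  have hw : ∑ g : Fin k → Equiv.Perm (Fin n),
      (∏ j, χ j (g j)) • ((fun m => x fun j => g j (m j)) - x) =
      ((∏ j with i j = z, c) * contrast x (supp z i) a) • contrastVector z i := by
    simp only [smul_sub]
    rw [Finset.sum_sub_distrib, ← Finset.sum_smul, hsum, zero_smul, sub_zero]
    ext m
    simp only [Finset.sum_apply, Pi.smul_apply, smul_eq_mul]
    rw [sum_weight_mul_comp]
    simp only [h1, Finset.prod_mul_distrib, Finset.prod_ite (fun _ => c), contrast]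
    rw [← contrastVector, Finset.mul_sum, Finset.sum_mul]
    refine Finset.sum_congr rfl fun p _ => ?_
    simp only [supp]
    ring
  have hmem := Submodule.sum_mem L fun g (_ : g ∈ univ) =>
    Submodule.smul_mem L (∏ j, χ j (g j)) (hL g)
  rw [hw] at hmem
  refine (Submodule.smul_mem_iff L (mul_ne_zero ?_ hc)).1 hmem
  exact Finset.prod_ne_zero_iff.2 fun _ _ => hc0

/-! ### Affine hulls of the two polytopes -/

theorem marginal_comp_perm (x : (Fin k → Fin n) → ℝ) (g : Fin k → Equiv.Perm (Fin n))
    (K : Finset (Fin k)) (a : Fin k → Fin n) :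
    marginal (fun m => x fun j => g j (m j)) K a = marginal x K fun j => g j (a j) := by
  simp only [marginal, Finset.sum_filter]
  exact Fintype.sum_equiv (Equiv.piCongrRight g) _ _ fun m =>
    if_congr (by simp) rfl rfl

/-- The integer feasible points; `integerPolytope` is their convex hull. -/
def integerPoints (n k s lam pmax : ℕ) : Set ((Fin k → Fin n) → ℝ) :=
  {x | x ∈ linearPolytope n k s lam pmax ∧ ∀ i, ∃ z : ℤ, x i = (z : ℝ)}

theorem comp_perm_mem_integerPoints (z : Fin n) {s lam pmax : ℕ} {x : (Fin k → Fin n) → ℝ}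
    (hx : x ∈ integerPoints n k s lam pmax) (g : Fin k → Equiv.Perm (Fin n)) :
    (fun m => x fun j => g j (m j)) ∈ integerPoints n k s lam pmax := by
  refine ⟨⟨(equalityConstraints_iff z).2 fun J hJ a => ?_, fun i => hx.1.2 _⟩, fun i => hx.2 _⟩
  rw [marginal_comp_perm]
  exact (equalityConstraints_iff z).1 hx.1.1 J hJ _

theorem sub_mem_homogeneousSolutions (z : Fin n) {s lam : ℕ} {x y : (Fin k → Fin n) → ℝ}
    (hx : x ∈ affineSolutionSet n k s lam) :
    y - x ∈ homogeneousSolutions n k s ↔ y ∈ affineSolutionSet n k s lam := by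
  have hx := (equalityConstraints_iff z).1 hx
  refine Iff.trans ?_ (equalityConstraints_iff z).symm
  refine forall₃_congr fun J hJ a => ?_
  rw [← hx J hJ a, ← sub_eq_zero (a := marginal y J a)]
  simp [marginal, Finset.sum_sub_distrib]

theorem span_contrastVector_le_vectorSpan (z : Fin n) {s lam pmax : ℕ} (hs : s < k)
    (hdvd : ∀ l ∈ Finset.Icc 1 (k - s), ¬ n ∣ lam * (s + l - 1).choose (l - 1))
    {x : (Fin k → Fin n) → ℝ} (hx : x ∈ integerPoints n k s lam pmax) :
    Submodule.span ℝ (contrastVector z '' {i | s < #(supp z i)}) ≤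
      vectorSpan ℝ (integerPoints n k s lam pmax) := by
  rw [Submodule.span_le]
  rintro _ ⟨i, hi, rfl⟩
  have hi : s < #(supp z i) := hi
  have hik : #(supp z i) ≤ k := by simpa using Finset.card_le_univ (supp z i)
  refine contrastVector_mem (x := x) (a := i)
    (fun g => vsub_mem_vectorSpan ℝ (comp_perm_mem_integerPoints z hx g) hx)
    (Finset.card_pos.1 (by omega))
    (contrast_ne_zero z.pos.ne' hs.le ((equalityConstraints_iff z).1 hx.1.1) hx.2 hi ?_ i)
  have := hdvd (#(supp z i) - s) (Finset.mem_Icc.2 ⟨by omega, by omega⟩)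
  rwa [show s + (#(supp z i) - s) - 1 = #(supp z i) - 1 by omega,
    ← Nat.choose_symm_of_eq_add (show #(supp z i) - 1 = s + (#(supp z i) - s - 1) by omega)]
    at this

theorem vectorSpan_le_homogeneousSolutions (z : Fin n) {s lam : ℕ}
    {S : Set ((Fin k → Fin n) → ℝ)} (hS : S ⊆ affineSolutionSet n k s lam) :
    vectorSpan ℝ S ≤ homogeneousSolutions n k s := by
  rw [vectorSpan_def, Submodule.span_le]
  rintro _ ⟨x, hx, y, hy, rfl⟩
  exact (sub_mem_homogeneousSolutions z (hS hy)).2 (hS hx)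

theorem affineSpan_eq_affineSolutionSet (z : Fin n) {s lam : ℕ}
    {S : Set ((Fin k → Fin n) → ℝ)} (hS : S ⊆ affineSolutionSet n k s lam) (hne : S.Nonempty)
    (hd : vectorSpan ℝ S = homogeneousSolutions n k s) :
    (affineSpan ℝ S : Set ((Fin k → Fin n) → ℝ)) = affineSolutionSet n k s lam := by
  obtain ⟨x, hx⟩ := hne
  ext y
  rw [SetLike.mem_coe, ← AffineSubspace.vsub_right_mem_direction_iff_mem
    (subset_affineSpan ℝ S hx), direction_affineSpan, hd]
  exact sub_mem_homogeneousSolutions z (hS hx)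

theorem linearPolytope_convex (z : Fin n) (k s lam pmax : ℕ) :
    Convex ℝ (linearPolytope n k s lam pmax) := by
  rintro x ⟨hx, hx'⟩ y ⟨hy, hy'⟩ a b ha hb hab
  rw [equalityConstraints_iff z] at hx hy
  refine ⟨(equalityConstraints_iff z).2 fun J hJ c => ?_, fun i => ?_⟩
  · have : marginal (a • x + b • y) J c = a * marginal x J c + b * marginal y J c := by
      simp [marginal, Finset.sum_add_distrib, Finset.mul_sum]
    rw [this, hx J hJ, hy J hJ, ← add_mul, hab, one_mul]
  · exact convex_Icc (0 : ℝ) pmax (hx' i) (hy' i) ha hb hab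

/-- Under the divisibility hypothesis, the integer polytope, if nonempty, spans the affine space of
the equality constraints. All spaces in the chain from the span of the contrast vectors of large
support through the direction spaces of the two polytopes to the homogeneous solutions agree. -/
theorem fullDimensional {n k s lam pmax : ℕ} (hn : 2 ≤ n) (hs : s < k)
    (hdvd : ∀ l ∈ Finset.Icc 1 (k - s), ¬ n ∣ lam * (s + l - 1).choose (l - 1))
    (hne : (integerPolytope n k s lam pmax).Nonempty) :
    (affineSpan ℝ (integerPolytope n k s lam pmax) : Set ((Fin k → Fin n) → ℝ)) =
        affineSolutionSet n k s lam ∧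
      affineDim (integerPolytope n k s lam pmax) = affineDim (linearPolytope n k s lam pmax) ∧
      (affineDim (linearPolytope n k s lam pmax) : ℤ) =
        (n : ℤ) ^ k - ∑ j ∈ Finset.range (s + 1), (k.choose j : ℤ) * ((n : ℤ) - 1) ^ j := by
  have z : Fin n := ⟨0, by omega⟩
  obtain ⟨x, hx⟩ : (integerPoints n k s lam pmax).Nonempty := convexHull_nonempty_iff.1 hne
  have hlin : linearPolytope n k s lam pmax ⊆ affineSolutionSet n k s lam := fun _ h => h.1
  have hint : integerPolytope n k s lam pmax ⊆ linearPolytope n k s lam pmax :=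
    convexHull_min (fun _ h => h.1) (linearPolytope_convex z k s lam pmax)
  have h1 := span_contrastVector_le_vectorSpan z hs hdvd hx
  have h2 : vectorSpan ℝ (integerPoints n k s lam pmax) ≤
      vectorSpan ℝ (integerPolytope n k s lam pmax) := vectorSpan_mono ℝ (subset_convexHull ℝ _)
  have h3 := vectorSpan_mono ℝ hint
  have h4 := vectorSpan_le_homogeneousSolutions z hlin
  have h5 := homogeneousSolutions_le_span (n := n) z hs.le
  have hI : vectorSpan ℝ (integerPolytope n k s lam pmax) = homogeneousSolutions n k s :=
    le_antisymm (h3.trans h4) (h5.trans (h1.trans h2))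
  have hP : vectorSpan ℝ (linearPolytope n k s lam pmax) = homogeneousSolutions n k s :=
    le_antisymm h4 (hI.symm.le.trans h3)
  have hspan := le_antisymm h5 (h1.trans (h2.trans (h3.trans h4)))
  refine ⟨affineSpan_eq_affineSolutionSet z (hint.trans hlin) hne hI, ?_, ?_⟩
  · rw [affineDim, affineDim, direction_affineSpan, direction_affineSpan, hI, hP]
  · rw [affineDim, direction_affineSpan, hP, hspan, finrank_span_contrastVector,
      card_lt_card_supp]

/-! ### Assignment polytopes -/

/-- The indicator of a set of tuples is a point of the assignment polytope if every choice of
symbols in `s` columns extends to exactly one tuple of the set. -/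
theorem integerPolytope_nonempty_of_indicator (z : Fin n) {s : ℕ}
    (A : (Fin k → Fin n) → Prop) [DecidablePred A]
    (hA : ∀ J : Finset (Fin k), #J = s → ∀ a : Fin k → Fin n,
      ∃! m : Fin k → Fin n, A m ∧ ∀ j ∈ J, m j = a j) :
    (integerPolytope n k s 1 1).Nonempty := by
  refine convexHull_nonempty_iff.2 ⟨fun m => if A m then 1 else 0,
    ⟨(equalityConstraints_iff z).2 fun J hJ a => ?_, fun m => ?_⟩, fun m => ?_⟩
  · obtain ⟨m, hm, huniq⟩ := hA J hJ a
    rw [marginal, Finset.sum_eq_single_of_mem m (by simpa using hm.2), if_pos hm.1, Nat.cast_one]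
    intro p hp hpm
    rw [mem_filter] at hp
    exact if_neg fun h => hpm (huniq p ⟨h, hp.2⟩)
  · dsimp only
    split_ifs <;> norm_num
  · exact ⟨if A m then 1 else 0, by push_cast; rfl⟩

theorem integerPolytope_zero_nonempty (z : Fin n) (k : ℕ) :
    (integerPolytope n k 0 1 1).Nonempty := by
  refine integerPolytope_nonempty_of_indicator z (fun m => m = fun _ => z) fun J hJ a => ?_
  rw [Finset.card_eq_zero] at hJ
  subst hJ
  exact ⟨fun _ => z, by simp, by simp⟩

theorem integerPolytope_one_nonempty (z : Fin n) (k : ℕ) :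
    (integerPolytope n k 1 1 1).Nonempty := by
  refine integerPolytope_nonempty_of_indicator z (fun m => ∃ b, m = fun _ => b) fun J hJ a => ?_
  obtain ⟨j, rfl⟩ := Finset.card_eq_one.1 hJ
  refine ⟨fun _ => a j, ⟨⟨a j, rfl⟩, by simp⟩, ?_⟩
  rintro _ ⟨⟨b, rfl⟩, h⟩
  rw [← h j (Finset.mem_singleton_self j)]

/-- The triples with sum zero in `ℤ/n` form a Latin square. -/
theorem integerPolytope_three_two_nonempty (z : Fin n) :
    (integerPolytope n 3 2 1 1).Nonempty := by
  have : NeZero n := ⟨z.pos.ne'⟩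
  refine integerPolytope_nonempty_of_indicator z (fun m => ∑ j, m j = 0) fun J hJ a => ?_
  obtain ⟨i, hi⟩ : ∃ i, Jᶜ = {i} := Finset.card_eq_one.1 (by simp [Finset.card_compl, hJ])
  obtain rfl : J = {i}ᶜ := by rw [← hi, compl_compl]
  have hsum (m : Fin 3 → Fin n) : ∑ j, m j = m i + ∑ j ∈ {i}ᶜ, m j := by
    rw [← Finset.sum_add_sum_compl {i}, Finset.sum_singleton]
  refine ⟨Function.update a i (-∑ j ∈ {i}ᶜ, a j), ⟨?_, fun j hj => ?_⟩, ?_⟩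
  · have : ∀ c, ∀ j ∈ ({i} : Finset (Fin 3))ᶜ, Function.update a i c j = a j :=
      fun c j hj => Function.update_of_ne (by simpa using hj) _ _
    rw [hsum, Function.update_self, Finset.sum_congr rfl (this _), neg_add_cancel]
  · exact Function.update_of_ne (by simpa using hj) _ _
  · rintro m ⟨h0, hm⟩
    rw [hsum, Finset.sum_congr rfl hm] at h0
    ext j
    by_cases hj : j = i
    · rw [hj, Function.update_self, eq_neg_of_add_eq_zero_left h0]
    · rw [Function.update_of_ne hj, hm j (by simpa using hj)]

theorem affineDim_integerPolytope {n k s : ℕ} (hn : 2 ≤ n) (hs : s < k)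
    (hdvd : ∀ l ∈ Finset.Icc 1 (k - s), ¬ n ∣ (s + l - 1).choose (l - 1))
    (hne : (integerPolytope n k s 1 1).Nonempty) :
    (affineDim (integerPolytope n k s 1 1) : ℤ) =
      (n : ℤ) ^ k - ∑ j ∈ Finset.range (s + 1), (k.choose j : ℤ) * ((n : ℤ) - 1) ^ j := by
  obtain ⟨-, h1, h2⟩ := fullDimensional hn hs (by simpa using hdvd) hne
  rw [h1, h2]

end OrthogonalArray

theorem mainTheorem2 :
    -- the general statement
    (∀ n k s lam pmax : ℕ, 2 ≤ n → s < k → 1 ≤ lam → 1 ≤ pmax → pmax ≤ lam →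
      (∀ l ∈ Finset.Icc 1 (k - s), ¬ n ∣ lam * (s + l - 1).choose (l - 1)) →
      (OrthogonalArray.integerPolytope n k s lam pmax).Nonempty →
      (affineSpan ℝ (OrthogonalArray.integerPolytope n k s lam pmax) :
          Set ((Fin k → Fin n) → ℝ)) = OrthogonalArray.affineSolutionSet n k s lam ∧
      OrthogonalArray.affineDim (OrthogonalArray.integerPolytope n k s lam pmax) =
        OrthogonalArray.affineDim (OrthogonalArray.linearPolytope n k s lam pmax) ∧
      (OrthogonalArray.affineDim (OrthogonalArray.linearPolytope n k s lam pmax) : ℤ) =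
        (n : ℤ) ^ k - ∑ j ∈ Finset.range (s + 1), (k.choose j : ℤ) * ((n : ℤ) - 1) ^ j) ∧
    -- the known values for assignment polytopes (`lam = pmax = 1`)
    (∀ n k : ℕ, 2 ≤ n → 1 ≤ k →
      (OrthogonalArray.affineDim (OrthogonalArray.integerPolytope n k 0 1 1) : ℤ) =
        (n : ℤ) ^ k - 1) ∧
    (∀ n : ℕ, 2 ≤ n →
      (OrthogonalArray.affineDim (OrthogonalArray.integerPolytope n 2 1 1 1) : ℤ) =
        ((n : ℤ) - 1) ^ 2) ∧
    (∀ n : ℕ, 3 ≤ n →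
      (OrthogonalArray.affineDim (OrthogonalArray.integerPolytope n 3 1 1 1) : ℤ) =
        (n : ℤ) ^ 3 - 3 * (n : ℤ) + 2) ∧
    (∀ n : ℕ, 4 ≤ n →
      (OrthogonalArray.affineDim (OrthogonalArray.integerPolytope n 3 2 1 1) : ℤ) =
        ((n : ℤ) - 1) ^ 3) ∧
    (∀ n : ℕ, 4 ≤ n → (OrthogonalArray.integerPolytope n 4 2 1 1).Nonempty →
      (OrthogonalArray.affineDim (OrthogonalArray.integerPolytope n 4 2 1 1) : ℤ) =
        (n : ℤ) ^ 4 - 6 * (n : ℤ) ^ 2 + 8 * (n : ℤ) - 3) := by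
  refine ⟨fun n k s lam pmax hn hs _ _ _ hdvd hne =>
    OrthogonalArray.fullDimensional hn hs hdvd hne, fun n k hn hk => ?_, fun n hn => ?_,
    fun n hn => ?_, fun n hn => ?_, fun n hn hne => ?_⟩
  · rw [OrthogonalArray.affineDim_integerPolytope hn (by omega) (fun l hl => ?_)
      (OrthogonalArray.integerPolytope_zero_nonempty ⟨0, by omega⟩ k)]
    · simp
    · rw [zero_add, Nat.choose_self, Nat.dvd_one]
      omega
  · rw [OrthogonalArray.affineDim_integerPolytope hn (by omega) (fun l hl => ?_)
      (OrthogonalArray.integerPolytope_one_nonempty ⟨0, by omega⟩ 2)]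
    · simp [Finset.sum_range_succ]
      ring
    · obtain rfl : l = 1 := by simpa using hl
      rw [Nat.sub_self, Nat.choose_zero_right, Nat.dvd_one]
      omega
  · rw [OrthogonalArray.affineDim_integerPolytope (by omega) (by omega) (fun l hl hdvd => ?_)
      (OrthogonalArray.integerPolytope_one_nonempty ⟨0, by omega⟩ 3)]
    · simp [Finset.sum_range_succ]
      ring
    · rw [Finset.mem_Icc] at hl
      obtain rfl | rfl : l = 1 ∨ l = 2 := by omega
      all_goals
        have := Nat.le_of_dvd (by decide) hdvd
        norm_num at this
        omega
  · rw [OrthogonalArray.affineDim_integerPolytope (by omega) (by omega) (fun l hl => ?_)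
      (OrthogonalArray.integerPolytope_three_two_nonempty ⟨0, by omega⟩)]
    · simp [Finset.sum_range_succ]
      ring
    · obtain rfl : l = 1 := by simpa using hl
      rw [Nat.sub_self, Nat.choose_zero_right, Nat.dvd_one]
      omega
  · rw [OrthogonalArray.affineDim_integerPolytope (by omega) (by omega) (fun l hl hdvd => ?_) hne]
    · simp [Finset.sum_range_succ, show Nat.choose 4 2 = 6 from rfl]
      ring
    · rw [Finset.mem_Icc] at hl
      obtain rfl | rfl : l = 1 ∨ l = 2 := by omega
      all_goals
        have := Nat.le_of_dvd (by decide) hdvd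
        norm_num at this
        omega
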